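/- Let $\mathcal G=(V,\mathcal B,E)$ be a Borel graph, i.e. $(V,\mathcal B)$ is a standard Borel space and $(V,E)$ is a simple graph whose edge relation is a Borel subset of $V\times V$. Suppose that its maximum degree $\Delta=\Delta(\mathcal G)$ is finite and that $\mathcal G$ contains no cycle of odd length. We regard edges as unordered pairs and give the set $E$ of edges the $\sigma$-algebra $\mathcal C$ inherited from the unordered pairs of $V$ (a set of edges belongs to $\mathcal C$ iff the corresponding symmetric set of ordered pairs is Borel in $V\times V$). A proper partial edge coloring with $\Delta+1$ colors is a Borel map $c$ from a Borel set $\operatorname{dom}(c)\subseteq E$ to a set of $\Delta+1$ colors such that any two distinct edges of $\operatorname{dom}(c)$ that share a vertex have different colors. Fix one of the $\Delta+1$ colors, $\mathbf a$. Given two proper partial edge colorings $c,d$, we say that $d$ improves $c$ if $\operatorname{dom}(d)=\operatorname{dom}(c)$ and $d^{-1}(\mathbf a)\subseteq c^{-1}(\mathbf a)$. Let $c$ be a proper partial edge coloring with $\Delta+1$ colors, and let $\eta$ be a probability measure on $(E,\mathcal C)$ that is quasi-invariant for the line graph $\mathcal E$ of $\mathcal G$ (the graph on $E$ in which two distinct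 edges are adjacent iff they share a vertex), meaning that for every $A\in\mathcal C$ we have $\eta(A)=0$ if and only if $\eta([A]_{\mathcal E})=0$, where $[A]_{\mathcal E}$ is the union of the connected components of $\mathcal E$ that meet $A$. Then for every $\varepsilon>0$ there is a proper partial edge coloring $d$ with $\Delta+1$ colors that improves $c$ and satisfies $\eta(d^{-1}(\mathbf a))<\varepsilon$. -/

import Mathlib

open MeasureTheory

namespace BorelGraph

/-- The edge relation is a measurable subset of `V × V`. A Borel graph is a graph on a standard
Borel space with this property. -/
def IsBorel {V : Type*} [MeasurableSpace V] (G : SimpleGraph V) : Prop :=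
  MeasurableSet {p : V × V | G.Adj p.1 p.2}

/-- The maximum degree `Δ(G)`, as an extended natural number. -/
noncomputable def maxDegree {V : Type*} (G : SimpleGraph V) : ℕ∞ :=
  ⨆ v : V, (G.neighborSet v).encard

/-- `Δ(G)` is finite. -/
def HasBoundedDegree {V : Type*} (G : SimpleGraph V) : Prop :=
  maxDegree G ≠ ⊤

/-- No cycle of `G` has odd length. -/
def HasNoOddCycles {V : Type*} (G : SimpleGraph V) : Prop :=
  ∀ (v : V) (p : G.Walk v v), p.IsCycle → ¬ Odd p.length

/-- The saturation of `A`: the union of the connected components of `H` that meet `A`. -/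
def saturation {X : Type*} (H : SimpleGraph X) (A : Set X) : Set X :=
  {x | ∃ a ∈ A, H.Reachable a x}

/-- A measure is `H`-quasi-invariant if exactly the null sets have null saturation. -/
def QuasiInvariant {X : Type*} [MeasurableSpace X] (H : SimpleGraph X) (μ : Measure X) : Prop :=
  ∀ A : Set X, MeasurableSet A → (μ A = 0 ↔ μ (saturation H A) = 0)

/-- A partial Borel map from the edges of `G` to a set of `k` colours; the value `none` means that
the edge is not in the domain. Edges are unordered pairs, and `G.edgeSet` carries the `σ`-algebra
induced from the quotient `σ`-algebra on `Sym2 V`, in which a set is measurable iff the set of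
ordered pairs lying over it is measurable in `V × V`. -/
structure PartialEdgeColoring {V : Type*} [MeasurableSpace V] (G : SimpleGraph V) (k : ℕ) where
  color : G.edgeSet → Option (Fin k)
  measurableSet_color : ∀ i : Fin k, MeasurableSet {e : G.edgeSet | color e = some i}

namespace PartialEdgeColoring

variable {V : Type*} [MeasurableSpace V] {G : SimpleGraph V} {k : ℕ}

/-- The set of coloured edges. -/
def dom (c : PartialEdgeColoring G k) : Set G.edgeSet :=
  {e | ∃ i : Fin k, c.color e = some i}

/-- The set `c⁻¹(i)` of edges of colour `i`. -/
def colorClass (c : PartialEdgeColoring G k) (i : Fin k) : Set G.edgeSet :=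
  {e | c.color e = some i}

/-- Distinct coloured edges with a common vertex have different colours. -/
def IsProper (c : PartialEdgeColoring G k) : Prop :=
  ∀ e ∈ c.dom, ∀ f ∈ c.dom, e ≠ f → (∃ v : V, v ∈ e.1 ∧ v ∈ f.1) → c.color e ≠ c.color f

/-- `d` improves `c` with respect to the colour `a`. -/
def Improves (a : Fin k) (d c : PartialEdgeColoring G k) : Prop :=
  d.dom = c.dom ∧ d.colorClass a ⊆ c.colorClass a

end PartialEdgeColoring

end BorelGraph

/-!
A fixed proportion of the edges of color `a` can be recolored with other colors while no new edge
receives color `a`. Repeating this, the measure of the color class tends to zero.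

An edge `xy` of color `a` has a color `i ≠ a` missing at `x` and a color `j ≠ a` missing at `y`, as
there are more colors than neighbors. One pair `(i, j)` occurs on a fixed proportion of the class.
If `i = j`, give all these edges the color `i`; they form a matching, so this is proper. If `i ≠ j`,
consider the Kempe chains: the components of the graph formed by the edges of color `i` or `j`. The
chains of `x` and of `y` are different, since otherwise an `i`-`j`-alternating path of even length
from `x` to `y` and the edge `xy` would form an odd cycle (`word_ne_of_bipartition`). Swapping `i`
and `j` on the chain of `y`, but not on that of `x`, makes `i` missing at both ends of `xy`. To do
so for many edges at once, swap along a random set of chains: each edge profits with probability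
`1/4`.

The set of chains must be Borel. The chains in question have an end, so they have finitely many
ends, and the least end with respect to a Borel embedding of `V` into `ℝ` is a Borel invariant that
separates them (`exists_measurable_invariant`). Approximating it by an invariant with finitely many
values, on which a cut is chosen (`exists_cut`), costs an arbitrarily small part of the measure.

Each color class is a Borel matching, hence by the Lusin–Souslin theorem the graph of a Borel
partial involution of `V`; measurability of all constructions rests on this
(`IsProper.measurable_mate`).
As the color class only ever shrinks, no mass has to be transported between different edges.
-/

namespace BorelGraph

/-! ### Graphs without odd cycles are bipartite -/

lemma length_of_isPath_of_mem_edges {V : Type*} {G : SimpleGraph V} {u v : V} (q : G.Walk v u)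
    (hq : q.IsPath) (he : s(u, v) ∈ q.edges) : q.length = 1 := by
  cases q with
  | nil => simp at he
  | cons h q' =>
    rw [SimpleGraph.Walk.cons_isPath_iff] at hq
    rw [SimpleGraph.Walk.edges_cons, List.mem_cons] at he
    rcases he with he | he
    · have : u = _ := Sym2.congr_left.1 (he.trans Sym2.eq_swap)
      subst this
      rw [SimpleGraph.Walk.length_cons,
        SimpleGraph.Walk.length_eq_zero_iff.2 (SimpleGraph.Walk.isPath_iff_nil.1 hq.1)]
    · exact absurd (q'.snd_mem_support_of_mem_edges he) hq.2

/-- Without odd cycles, shortcutting a walk to a path preserves the parity of its length, as the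
loops that are cut out are cycles or consist of one edge traversed back and forth. -/
lemma even_length_bypass_iff {V : Type*} [DecidableEq V] {G : SimpleGraph V}
    (hodd : HasNoOddCycles G) {u v : V} (p : G.Walk u v) :
    Even p.bypass.length ↔ Even p.length := by
  induction p with
  | nil => simp [SimpleGraph.Walk.bypass]
  | @cons u v w h p ih =>
    rw [SimpleGraph.Walk.length_cons, Nat.even_add_one, ← ih, SimpleGraph.Walk.bypass]
    split_ifs with hs
    · set q := p.bypass.takeUntil u hs
      have hq : q.IsPath := p.bypass_isPath.takeUntil hs
      have hlen : q.length + (p.bypass.dropUntil u hs).length = p.bypass.length := by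
        rw [← SimpleGraph.Walk.length_append, SimpleGraph.Walk.take_spec]
      have hqo : ¬ Even q.length := by
        by_cases he : s(u, v) ∈ q.edges
        · simp [length_of_isPath_of_mem_edges q hq he]
        · have := hodd u (.cons h q) ((SimpleGraph.Walk.cons_isCycle_iff q h).2 ⟨hq, he⟩)
          rwa [SimpleGraph.Walk.length_cons, Nat.not_odd_iff_even, Nat.even_add_one] at this
      rw [← hlen, Nat.even_add]
      tauto
    · rw [SimpleGraph.Walk.length_cons, Nat.even_add_one]

lemma HasNoOddCycles.exists_bool_coloring {V : Type*} {G : SimpleGraph V}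
    (hodd : HasNoOddCycles G) : ∃ b : V → Bool, ∀ x y, G.Adj x y → b x ≠ b y := by
  classical
  have h2 : G.Colorable 2 := by
    rw [SimpleGraph.two_colorable_iff_forall_loop_even]
    intro u w
    rw [← even_length_bypass_iff hodd w, SimpleGraph.Walk.length_eq_zero_iff.2
      (SimpleGraph.Walk.isPath_iff_nil.1 w.bypass_isPath)]
    simp
  obtain ⟨C⟩ := h2
  exact ⟨fun x => finTwoEquiv (C x), fun x y h he => C.valid h (finTwoEquiv.injective he)⟩

/-! ### Orbits of two involutions -/

/-- The composition of `s` (for `true`) and `t` (for `false`) along a word. For involutions `s` and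
`t`, the points `word s t w x` form the orbit of `x` under the dihedral group they generate. -/
def word {X : Type*} (s t : X → X) : List Bool → X → X
  | [], x => x
  | b :: w, x => (if b then s else t) (word s t w x)

section Involutions

variable {X : Type*} {s t : X → X}

lemma word_append (w w' : List Bool) (x : X) :
    word s t (w ++ w') x = word s t w (word s t w' x) := by
  induction w with
  | nil => rfl
  | cons b w ih => simp only [List.cons_append, word, ih]

lemma word_reverse (hs : Function.Involutive s) (ht : Function.Involutive t) (w : List Bool)
    (x : X) : word s t w.reverse (word s t w x) = x := by
  induction w with
  | nil => rfl
  | cons b w ih =>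
    rw [List.reverse_cons, word_append]
    cases b <;> simp [word, hs _, ht _, ih]

lemma word_mem {A : Set X} (hs : ∀ x ∈ A, s x ∈ A) (ht : ∀ x ∈ A, t x ∈ A) {x : X} (hx : x ∈ A)
    (w : List Bool) : word s t w x ∈ A := by
  induction w with
  | nil => exact hx
  | cons b w ih => cases b <;> simp [word, hs _ ih, ht _ ih]

/-- The alternating walk `x, t x, s (t x), t (s (t x)), …`. If `s x = x`, it runs through the orbit
of `x` under the involutions `s` and `t`. -/
def altWalk (s t : X → X) (x : X) : ℕ → X
  | 0 => x
  | n + 1 => if Even n then t (altWalk s t x n) else s (altWalk s t x n)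

lemma altWalk_cases (hs : Function.Involutive s) (ht : Function.Involutive t) {x : X}
    (hx : s x = x) (n : ℕ) :
    (Even n ∧ t (altWalk s t x n) = altWalk s t x (n + 1) ∧
      s (altWalk s t x n) = altWalk s t x (n - 1)) ∨
    (¬ Even n ∧ 1 ≤ n ∧ s (altWalk s t x n) = altWalk s t x (n + 1) ∧
      t (altWalk s t x n) = altWalk s t x (n - 1)) := by
  by_cases hn : Even n
  · refine .inl ⟨hn, by simp [altWalk, hn], ?_⟩
    cases n with
    | zero => exact hx
    | succ m =>
      have hm : ¬ Even m := Nat.even_add_one.1 hn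
      simp [altWalk, hm, hs _]
  · refine .inr ⟨hn, ?_, by simp [altWalk, hn], ?_⟩
    · exact Nat.one_le_iff_ne_zero.2 (by rintro rfl; simp at hn)
    · cases n with
      | zero => simp at hn
      | succ m =>
        have hm : Even m := by simpa [Nat.even_add_one] using hn
        simp [altWalk, hm, ht _]

lemma word_mem_range_altWalk (hs : Function.Involutive s) (ht : Function.Involutive t) {x : X}
    (hx : s x = x) (w : List Bool) : ∃ n, word s t w x = altWalk s t x n := by
  have : word s t w x ∈ Set.range (altWalk s t x) := by
    refine word_mem (A := Set.range (altWalk s t x)) ?_ ?_ ⟨0, rfl⟩ w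
    · rintro _ ⟨n, rfl⟩
      rcases altWalk_cases hs ht hx n with h | h
      exacts [⟨_, h.2.2.symm⟩, ⟨_, h.2.2.1.symm⟩]
    · rintro _ ⟨n, rfl⟩
      rcases altWalk_cases hs ht hx n with h | h
      exacts [⟨_, h.2.1.symm⟩, ⟨_, h.2.2.2.symm⟩]
  obtain ⟨n, hn⟩ := this
  exact ⟨n, hn.symm⟩

/-- Once the alternating walk stalls, it has seen the whole orbit. -/
lemma word_mem_image_altWalk (hs : Function.Involutive s) (ht : Function.Involutive t) {x : X}
    (hx : s x = x) {m : ℕ} (hm : altWalk s t x (m + 1) = altWalk s t x m) (w : List Bool) :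
    ∃ n ≤ m, word s t w x = altWalk s t x n := by
  have : word s t w x ∈ altWalk s t x '' Set.Iic m := by
    have key : ∀ n ≤ m, ∀ y, (y = altWalk s t x (n + 1) ∨ y = altWalk s t x (n - 1)) →
        y ∈ altWalk s t x '' Set.Iic m := by
      rintro n hn y (rfl | rfl)
      · rcases hn.eq_or_lt with rfl | h
        · exact ⟨n, by simp, hm.symm⟩
        · exact ⟨n + 1, by simpa using h, rfl⟩
      · exact ⟨n - 1, by simp; omega, rfl⟩
    refine word_mem (A := altWalk s t x '' Set.Iic m) ?_ ?_ ⟨0, by simp, rfl⟩ w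
    · rintro _ ⟨n, hn, rfl⟩
      rcases altWalk_cases hs ht hx n with h | h
      exacts [key n hn _ (.inr h.2.2), key n hn _ (.inl h.2.2.1)]
    · rintro _ ⟨n, hn, rfl⟩
      rcases altWalk_cases hs ht hx n with h | h
      exacts [key n hn _ (.inl h.2.1), key n hn _ (.inr h.2.2.2)]
  obtain ⟨n, hn, h⟩ := this
  exact ⟨n, hn, h.symm⟩

/-- An orbit that contains a fixed point of `s` contains only finitely many fixed points of `s` or
`t`: it is a path, and the fixed points are its ends. -/
lemma finite_fixed_points_orbit (hs : Function.Involutive s) (ht : Function.Involutive t) {x : X}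
    (hx : s x = x) : {z | (s z = z ∨ t z = z) ∧ ∃ w, word s t w x = z}.Finite := by
  by_cases h : ∃ m, altWalk s t x (m + 1) = altWalk s t x m
  · obtain ⟨m, hm⟩ := h
    refine ((Set.finite_Iic m).image (altWalk s t x)).subset ?_
    rintro z ⟨-, w, rfl⟩
    obtain ⟨n, hn, h⟩ := word_mem_image_altWalk hs ht hx hm w
    exact ⟨n, hn, h.symm⟩
  · refine (Set.finite_singleton x).subset ?_
    rintro z ⟨hz, w, rfl⟩
    obtain ⟨n, hn⟩ := word_mem_range_altWalk hs ht hx w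
    rw [hn] at hz ⊢
    cases n with
    | zero => rfl
    | succ n =>
      refine absurd ?_ h
      have h1 := altWalk_cases hs ht hx (n + 1)
      simp only [Nat.add_sub_cancel] at h1
      rcases hz with hz | hz <;> rcases h1 with h1 | h1
      · exact ⟨n, hz.symm.trans h1.2.2⟩
      · exact ⟨n + 1, h1.2.2.1.symm.trans hz⟩
      · exact ⟨n + 1, h1.2.1.symm.trans hz⟩
      · exact ⟨n, hz.symm.trans h1.2.2.2⟩

/-- If `s` and `t` respect a bipartition, then a fixed point of `s` and a fixed point of `t` on
different sides lie in different orbits: an alternating path between them would have odd length,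
hence start and end with an edge of the same involution. -/
lemma word_ne_of_bipartition (hs : Function.Involutive s) (ht : Function.Involutive t)
    {b : X → Bool} (hbs : ∀ z, s z ≠ z → b (s z) ≠ b z) (hbt : ∀ z, t z ≠ z → b (t z) ≠ b z)
    {x y : X} (hx : s x = x) (hy : t y = y) (hb : b x ≠ b y) (w : List Bool) :
    word s t w x ≠ y := by
  classical
  intro hw
  have hex : ∃ n, altWalk s t x n = y := by
    obtain ⟨n, hn⟩ := word_mem_range_altWalk hs ht hx w
    exact ⟨n, hn.symm.trans hw⟩
  set N := Nat.find hex
  have hN : altWalk s t x N = y := Nat.find_spec hex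
  have hmin : ∀ m < N, altWalk s t x m ≠ y := fun m hm => Nat.find_min hex hm
  have hmove : ∀ m < N, altWalk s t x (m + 1) ≠ altWalk s t x m := by
    intro m hm h
    obtain ⟨n, hn, h'⟩ := word_mem_image_altWalk hs ht hx h w
    exact hmin n (hn.trans_lt hm) (h'.symm.trans hw)
  have hpar : ∀ m ≤ N, (b (altWalk s t x m) = b x ↔ Even m) := by
    intro m
    induction m with
    | zero => simp [altWalk]
    | succ m ih =>
      intro hm
      have h1 := ih (by omega)
      have h2 := hmove m hm
      have h3 : b (altWalk s t x (m + 1)) ≠ b (altWalk s t x m) := by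
        rcases altWalk_cases hs ht hx m with h | h
        · rw [← h.2.1] at h2 ⊢
          exact hbt _ h2
        · rw [← h.2.2.1] at h2 ⊢
          exact hbs _ h2
      rw [Nat.even_add_one, ← h1]
      revert h3
      cases b (altWalk s t x (m + 1)) <;> cases b (altWalk s t x m) <;> cases b x <;> simp
  have hNo : ¬ Even N := by
    rw [← hpar N le_rfl, hN]
    exact hb.symm
  rcases altWalk_cases hs ht hx N with h | h
  · exact hNo h.1
  · refine hmin (N - 1) (by omega) ?_
    rw [← h.2.2.2, hN, hy]

end Involutions

/-! ### Invariant functions that separate orbits -/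

section Separating

variable {X : Type*} [MeasurableSpace X] {s t : X → X}

lemma measurable_word (hsm : Measurable s) (htm : Measurable t) (w : List Bool) :
    Measurable (word s t w) := by
  induction w with
  | nil => exact measurable_id
  | cons b w ih =>
    cases b
    exacts [htm.comp ih, hsm.comp ih]

/-- A Borel invariant of the orbits of two Borel involutions `s` and `t` that separates all orbits
containing a fixed point: the least fixed point of `s` or `t` in the orbit, with respect to an
embedding into the real line. -/
lemma exists_measurable_invariant [StandardBorelSpace X]
    (hs : Function.Involutive s) (ht : Function.Involutive t)
    (hsm : Measurable s) (htm : Measurable t) :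
    ∃ F : X → EReal, Measurable F ∧ (∀ x, F (s x) = F x) ∧ (∀ x, F (t x) = F x) ∧
      ∀ x y, s x = x → t y = y → F x = F y → ∃ w, word s t w x = y := by
  classical
  set M : Set X := {z | s z = z ∨ t z = z}
  have hM : MeasurableSet M :=
    (measurableSet_eq_fun hsm measurable_id).union (measurableSet_eq_fun htm measurable_id)
  set φ : X → EReal := fun x => (embeddingReal X x : EReal)
  have hφ : Measurable φ := (measurableEmbedding_embeddingReal X).measurable.coe_real_ereal
  have hφi : Function.Injective φ :=
    EReal.coe_injective.comp (measurableEmbedding_embeddingReal X).injective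
  set ψ : X → EReal := fun x => if x ∈ M then φ x else ⊤
  have hψ : Measurable ψ := Measurable.ite hM hφ measurable_const
  set F : X → EReal := fun x => ⨅ w, ψ (word s t w x)
  have hle : ∀ (x : X) (u : List Bool), F x ≤ F (word s t u x) := by
    intro x u
    refine le_iInf fun w => ?_
    rw [← word_append]
    exact iInf_le (fun w => ψ (word s t w x)) (w ++ u)
  have hinv : ∀ (x : X) (u : List Bool), F (word s t u x) = F x := by
    intro x u
    refine le_antisymm ?_ (hle x u)
    conv_rhs => rw [← word_reverse hs ht u x]
    exact hle _ _
  have hatt : ∀ x ∈ M, {z | z ∈ M ∧ ∃ w, word s t w x = z}.Finite →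
      ∃ w, word s t w x ∈ M ∧ F x = φ (word s t w x) := by
    intro x hx hfin
    have hr : (Set.range fun w => ψ (word s t w x)).Finite := by
      refine ((hfin.image φ).insert ⊤).subset ?_
      rintro _ ⟨w, rfl⟩
      by_cases h : word s t w x ∈ M
      · exact .inr ⟨_, ⟨h, w, rfl⟩, by simp [ψ, h]⟩
      · exact .inl (by simp [ψ, h])
    obtain ⟨w, hw⟩ := (Set.range_nonempty fun w => ψ (word s t w x)).csInf_mem hr
    have hw : ψ (word s t w x) = F x := hw
    have hlt : F x < ⊤ := by
      refine (iInf_le (fun w => ψ (word s t w x)) []).trans_lt ?_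
      simp [ψ, word, hx, φ]
    by_cases h : word s t w x ∈ M
    · exact ⟨w, h, by rw [← hw]; simp [ψ, h]⟩
    · rw [← hw] at hlt
      simp [ψ, h] at hlt
  refine ⟨F, Measurable.iInf fun w => hψ.comp (measurable_word hsm htm w),
    fun x => hinv x [true], fun x => hinv x [false], fun x y hx hy hxy => ?_⟩
  obtain ⟨w, -, h1⟩ := hatt x (.inl hx) (finite_fixed_points_orbit hs ht hx)
  obtain ⟨w', -, h2⟩ := hatt y (.inr hy) (by
    have hsw : ∀ (w : List Bool) z, word t s (w.map not) z = word s t w z := by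
      intro w z
      induction w with
      | nil => rfl
      | cons b w ih => cases b <;> simp [word, ih]
    refine (finite_fixed_points_orbit ht hs hy).subset ?_
    rintro z ⟨hz, w, hw⟩
    exact ⟨hz.symm, w.map not, (hsw w y).trans hw⟩)
  refine ⟨w'.reverse ++ w, ?_⟩
  rw [word_append, hφi (h1.symm.trans (hxy.trans h2)), word_reverse hs ht]

end Separating

/-! ### A random cut -/

/-- A family of sets indexed by the cuts `g` of a finite set `I`: if every point of `A` belongs to
`S g` whenever `g` separates a pair of elements of `I` in the right order, then some `S g` carries
a quarter of the measure of `A`, since a random cut separates a pair with probability `1/4`. -/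
lemma exists_cut {E I : Type*} [MeasurableSpace E] [Fintype I] [DecidableEq I] (μ : Measure E)
    {A : Set E} (hA : MeasurableSet A) (S : (I → Bool) → Set E) (hS : ∀ g, MeasurableSet (S g))
    (h : ∀ e ∈ A, ∃ i j : I, i ≠ j ∧ ∀ g : I → Bool, g i = false → g j = true → e ∈ S g) :
    ∃ g, μ A ≤ 4 * μ (S g) := by
  classical
  have key : ∀ e, ∑ _g : I → Bool, A.indicator (1 : E → ENNReal) e ≤
      ∑ g : I → Bool, 4 * (S g).indicator (1 : E → ENNReal) e := by
    intro e
    by_cases he : e ∈ A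
    · obtain ⟨i, j, hij, hg⟩ := h e he
      -- a cut is determined by its values at `i` and `j` and by the cut obtained by resetting these
      let Ψ : (I → Bool) → {g : I → Bool // e ∈ S g} × Bool × Bool := fun g =>
        (⟨Function.update (Function.update g i false) j true,
          hg _ (by simp [Function.update_of_ne hij]) (by simp)⟩, g i, g j)
      have hΨ : Function.Injective Ψ := by
        intro g g' hgg
        simp only [Ψ, Prod.mk.injEq, Subtype.mk.injEq] at hgg
        funext k
        by_cases hki : k = i
        · rw [hki, hgg.2.1]
        by_cases hkj : k = j
        · rw [hkj, hgg.2.2]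
        simpa [Function.update_of_ne hki, Function.update_of_ne hkj] using congrFun hgg.1 k
      have hcard := Fintype.card_le_of_injective Ψ hΨ
      rw [Fintype.card_prod, Fintype.card_prod, Fintype.card_bool, Fintype.card_subtype] at hcard
      simp only [Set.indicator_of_mem he, Pi.one_apply, Finset.sum_const, Finset.card_univ,
        nsmul_one]
      rw [← Finset.mul_sum]
      simp only [Set.indicator_apply, Pi.one_apply, Finset.sum_boole]
      calc (Fintype.card (I → Bool) : ENNReal)
          ≤ ((Finset.card {g | e ∈ S g} * (2 * 2) : ℕ) : ENNReal) := by exact_mod_cast hcard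
        _ = 4 * (Finset.card {g | e ∈ S g} : ENNReal) := by push_cast; ring
    · simp [he]
  have hint := lintegral_mono (μ := μ) key
  rw [lintegral_finsetSum _ fun g _ => measurable_one.indicator hA,
    lintegral_finsetSum _ fun g _ => (measurable_one.indicator (hS g)).const_mul 4] at hint
  obtain ⟨g, -, hg⟩ := ENNReal.exists_le_of_sum_le Finset.univ_nonempty hint
  refine ⟨g, ?_⟩
  rwa [lintegral_indicator_one hA, lintegral_const_mul _ (measurable_one.indicator (hS g)),
    lintegral_indicator_one (hS g)] at hg

/-! ### Borel sets of edges -/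

section Edges

variable {V : Type*} [MeasurableSpace V] {G : SimpleGraph V}

/-- A set of edges of a Borel graph is measurable iff its set of ordered pairs is. -/
lemma measurableSet_edgeSet_iff (hG : IsBorel G) {S : Set G.edgeSet} :
    MeasurableSet S ↔
      MeasurableSet {p : V × V | ∃ h : G.Adj p.1 p.2, (⟨s(p.1, p.2), h⟩ : G.edgeSet) ∈ S} := by
  constructor
  · rintro ⟨U, hU, rfl⟩
    have hU' : MeasurableSet {p : V × V | s(p.1, p.2) ∈ U} := hU
    convert! MeasurableSet.inter (hG : MeasurableSet {p : V × V | G.Adj p.1 p.2}) hU' using 1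
    ext p
    simp
  · intro h
    refine ⟨Subtype.val '' S, ?_, Set.preimage_image_eq _ Subtype.val_injective⟩
    change MeasurableSet {p : V × V | s(p.1, p.2) ∈ Subtype.val '' S}
    convert! h using 1
    ext p
    constructor
    · rintro ⟨⟨e, he⟩, hS, rfl⟩
      exact ⟨he, hS⟩
    · rintro ⟨h, hS⟩
      exact ⟨_, hS, rfl⟩

lemma measurableSet_exists_mem (hG : IsBorel G) {P : V → V → Prop}
    (hP : MeasurableSet {p : V × V | P p.1 p.2}) :
    MeasurableSet {e : G.edgeSet | ∃ x y, e.1 = s(x, y) ∧ P x y} := by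
  rw [measurableSet_edgeSet_iff hG]
  convert! MeasurableSet.inter (hG : MeasurableSet {p : V × V | G.Adj p.1 p.2})
    (hP.union (measurable_swap hP)) using 1
  ext ⟨x, y⟩
  simp only [Set.mem_ofPred_eq, Sym2.eq_iff, Set.mem_inter_iff, Set.mem_union, Set.mem_preimage,
    Prod.fst_swap, Prod.snd_swap]
  constructor
  · rintro ⟨h, x', y', ⟨rfl, rfl⟩ | ⟨rfl, rfl⟩, hp⟩
    exacts [⟨h, .inl hp⟩, ⟨h, .inr hp⟩]
  · rintro ⟨h, hp | hp⟩
    exacts [⟨h, x, y, .inl ⟨rfl, rfl⟩, hp⟩, ⟨h, y, x, .inr ⟨rfl, rfl⟩, hp⟩]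

lemma measurableSet_exists_vertex (hG : IsBorel G) {M : Set V} (hM : MeasurableSet M) :
    MeasurableSet {e : G.edgeSet | ∃ v ∈ e.1, v ∈ M} := by
  convert! measurableSet_exists_mem hG (P := fun x _ => x ∈ M) (measurable_fst hM) using 1
  ext e
  constructor
  · rintro ⟨v, ⟨w, hw⟩, hv⟩
    exact ⟨v, w, hw, hv⟩
  · rintro ⟨v, w, hw, hv⟩
    exact ⟨v, ⟨w, hw⟩, hv⟩

lemma measurableSet_forall_vertex (hG : IsBorel G) {M : Set V} (hM : MeasurableSet M) :
    MeasurableSet {e : G.edgeSet | ∀ v ∈ e.1, v ∈ M} := by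
  convert! (measurableSet_exists_vertex hG hM.compl).compl using 1
  ext e
  simp

end Edges

namespace PartialEdgeColoring

variable {V : Type*} [MeasurableSpace V] {G : SimpleGraph V} {k : ℕ}

lemma Improves.trans {a : Fin k} {c d e : PartialEdgeColoring G k} (h : Improves a e d)
    (h' : Improves a d c) : Improves a e c :=
  ⟨h.1.trans h'.1, h.2.trans h'.2⟩

lemma IsProper.eq_of_color_eq {c : PartialEdgeColoring G k} (hc : c.IsProper) {e f : G.edgeSet}
    {i : Fin k} (he : c.color e = some i) (hf : c.color f = some i) {v : V} (hve : v ∈ e.1)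
    (hvf : v ∈ f.1) : e = f := by
  by_contra hne
  exact hc e ⟨i, he⟩ f ⟨i, hf⟩ hne ⟨v, hve, hvf⟩ (he.trans hf.symm)

lemma isProper_of_eq_of_color_eq {c : PartialEdgeColoring G k}
    (h : ∀ e f : G.edgeSet, ∀ i : Fin k, c.color e = some i → c.color f = some i →
      ∀ v : V, v ∈ e.1 → v ∈ f.1 → e = f) : c.IsProper := by
  rintro e ⟨i, hi⟩ f - hne ⟨v, hve, hvf⟩ hef
  exact hne (h e f i hi (hef ▸ hi) v hve hvf)

/-! ### The Borel matchings given by the colors -/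

/-- The vertices `x` and `y` are joined by an edge of color `i`. -/
def Joined (c : PartialEdgeColoring G k) (i : Fin k) (x y : V) : Prop :=
  ∃ h : G.Adj x y, c.color ⟨s(x, y), h⟩ = some i

/-- The color `i` is missing at the vertex `x`. -/
def Misses (c : PartialEdgeColoring G k) (i : Fin k) (x : V) : Prop :=
  ∀ y, ¬ c.Joined i x y

open Classical in
/-- The neighbor of `x` along the edge of color `i`, or `x` itself if `i` is missing at `x`. -/
noncomputable def mate (c : PartialEdgeColoring G k) (i : Fin k) (x : V) : V :=
  if h : ∃ y, c.Joined i x y then h.choose else x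

variable {c : PartialEdgeColoring G k} {i : Fin k}

lemma Joined.symm {x y : V} (h : c.Joined i x y) : c.Joined i y x := by
  obtain ⟨h, hi⟩ := h
  refine ⟨h.symm, ?_⟩
  convert! hi using 3
  exact Subtype.ext Sym2.eq_swap

lemma Misses.color_ne {x : V} (h : c.Misses i x) {e : G.edgeSet} (hx : x ∈ e.1) :
    c.color e ≠ some i := by
  obtain ⟨e, he⟩ := e
  obtain ⟨y, rfl⟩ := hx
  exact fun hi => h y ⟨he, hi⟩

lemma IsProper.joined_unique (hc : c.IsProper) {x y z : V} (hy : c.Joined i x y)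
    (hz : c.Joined i x z) : y = z := by
  obtain ⟨h, hi⟩ := hy
  obtain ⟨h', hi'⟩ := hz
  have := hc.eq_of_color_eq hi hi' (v := x) (by simp) (by simp)
  exact Sym2.congr_right.1 (congrArg Subtype.val this)

lemma IsProper.mate_eq (hc : c.IsProper) {x y : V} (h : c.Joined i x y) : c.mate i x = y := by
  have hex : ∃ y, c.Joined i x y := ⟨y, h⟩
  rw [mate, dif_pos hex]
  exact hc.joined_unique hex.choose_spec h

lemma Misses.mate_eq {x : V} (h : c.Misses i x) : c.mate i x = x := by
  rw [mate, dif_neg (fun ⟨y, hy⟩ => h y hy)]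

lemma joined_mate {x : V} (h : ¬ c.Misses i x) : c.Joined i x (c.mate i x) := by
  have hex : ∃ y, c.Joined i x y := by simpa [Misses] using h
  rw [mate, dif_pos hex]
  exact hex.choose_spec

lemma adj_mate {x : V} (h : c.mate i x ≠ x) : G.Adj x (c.mate i x) :=
  (joined_mate fun h' => h h'.mate_eq).1

lemma IsProper.involutive_mate (hc : c.IsProper) (i : Fin k) :
    Function.Involutive (c.mate i) := by
  intro x
  by_cases h : c.Misses i x
  · rw [h.mate_eq, h.mate_eq]
  · exact hc.mate_eq (joined_mate h).symm

lemma measurableSet_joined (hG : IsBorel G) (c : PartialEdgeColoring G k) (i : Fin k) :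
    MeasurableSet {p : V × V | c.Joined i p.1 p.2} :=
  (measurableSet_edgeSet_iff hG).1 (c.measurableSet_color i)

/-- The projection of a color class to the vertices is injective on the ordered edges of that
color, so the Lusin–Souslin theorem applies. -/
lemma IsProper.measurableSet_exists_joined [StandardBorelSpace V] (hG : IsBorel G)
    (hc : c.IsProper) (i : Fin k) {B : Set V} (hB : MeasurableSet B) :
    MeasurableSet {x | ∃ y ∈ B, c.Joined i x y} := by
  have h := ((measurableSet_joined hG c i).inter
    (measurable_snd hB)).image_of_measurable_injOn measurable_fst (by
      rintro ⟨x, y⟩ ⟨h, -⟩ ⟨x', y'⟩ ⟨h', -⟩ hx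
      obtain rfl : x = x' := hx
      exact Prod.ext rfl (hc.joined_unique h h'))
  convert! h using 1
  ext x
  constructor
  · rintro ⟨y, hy, h⟩
    exact ⟨(x, y), ⟨h, hy⟩, rfl⟩
  · rintro ⟨⟨x, y⟩, ⟨h, hy⟩, rfl⟩
    exact ⟨y, hy, h⟩

lemma IsProper.measurableSet_misses [StandardBorelSpace V] (hG : IsBorel G)
    (hc : c.IsProper) (i : Fin k) : MeasurableSet {x | c.Misses i x} := by
  convert! (hc.measurableSet_exists_joined hG i MeasurableSet.univ).compl using 1
  ext x
  simp [Misses]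

lemma IsProper.measurable_mate [StandardBorelSpace V] (hG : IsBorel G)
    (hc : c.IsProper) (i : Fin k) : Measurable (c.mate i) := by
  intro B hB
  convert! (hc.measurableSet_exists_joined hG i hB).union
    ((hc.measurableSet_misses hG i).inter hB) using 1
  ext x
  simp only [Set.mem_preimage, Set.mem_union, Set.mem_ofPred_eq, Set.mem_inter_iff]
  by_cases h : c.Misses i x
  · rw [h.mate_eq]
    constructor
    · exact fun hx => .inr ⟨h, hx⟩
    · rintro (⟨y, -, hy⟩ | hx)
      exacts [absurd hy (h y), hx.2]
  · constructor
    · exact fun hx => .inl ⟨_, hx, joined_mate h⟩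
    · rintro (⟨y, hy, hj⟩ | hx)
      · rwa [hc.mate_eq hj]
      · exact absurd hx.1 h

/-- If no color but possibly `a` is missing at an end of an edge of color `a`, then that vertex has
as many neighbors as there are colors. -/
lemma exists_misses {a : Fin k} (hk : maxDegree G < k) {e : G.edgeSet}
    (he : c.color e = some a) {x : V} (hx : x ∈ e.1) : ∃ i, i ≠ a ∧ c.Misses i x := by
  by_contra! h
  have h' : ∀ i, ¬ c.Misses i x := by
    intro i
    by_cases hi : i = a
    · rw [hi]
      exact fun hm => hm.color_ne hx he
    · exact h i hi
  have hinj : Function.Injective fun i : Fin k => c.mate i x := by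
    intro i j hij
    obtain ⟨h1, h2⟩ := joined_mate (h' i)
    obtain ⟨h3, h4⟩ := joined_mate (h' j)
    simp only at hij
    simp only [hij] at h2
    exact Option.some.inj (h2.symm.trans h4)
  have hsub : Set.range (fun i : Fin k => c.mate i x) ⊆ G.neighborSet x := by
    rintro _ ⟨i, rfl⟩
    exact (joined_mate (h' i)).1
  have h1 := Set.encard_le_encard hsub
  rw [← Set.image_univ, hinj.encard_image, Set.encard_univ, ENat.card_eq_coe_fintype_card,
    Fintype.card_fin] at h1
  have h2 : (G.neighborSet x).encard ≤ maxDegree G :=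
    le_iSup (fun v => (G.neighborSet v).encard) x
  exact absurd (h1.trans h2) hk.not_ge

/-! ### Swapping two colors, and filling in a missing color -/

open Classical in
/-- Exchange the colors `i` and `j` on the edges that meet `{f = true}`. For proper colorings this
is used with `f` constant on the edges of color `i` or `j`; the other edges are not affected. -/
noncomputable def swap (hG : IsBorel G) (c : PartialEdgeColoring G k) (i j : Fin k) {f : V → Bool}
    (hf : Measurable f) : PartialEdgeColoring G k where
  color e := if ∃ v ∈ e.1, f v = true then (c.color e).map (Equiv.swap i j) else c.color e
  measurableSet_color l := by
    have hS : MeasurableSet {e : G.edgeSet | ∃ v ∈ e.1, f v = true} :=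
      measurableSet_exists_vertex hG (hf (measurableSet_singleton true))
    convert! (hS.inter (c.measurableSet_color (Equiv.swap i j l))).union
      (hS.compl.inter (c.measurableSet_color l)) using 1
    ext e
    simp only [Set.mem_ofPred_eq, Set.mem_union, Set.mem_inter_iff, Set.mem_compl_iff]
    split_ifs with h
    · simp [h, Equiv.swap_apply_eq_iff]
    · simp [h]

open Classical in
/-- Give the color `i` to all edges of color `a` at both of whose ends `i` is missing. -/
noncomputable def fill [StandardBorelSpace V] (hG : IsBorel G) (c : PartialEdgeColoring G k)
    (hc : c.IsProper) (a i : Fin k) : PartialEdgeColoring G k where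
  color e := if c.color e = some a ∧ ∀ v ∈ e.1, c.Misses i v then some i else c.color e
  measurableSet_color l := by
    have hS : MeasurableSet {e : G.edgeSet | c.color e = some a ∧ ∀ v ∈ e.1, c.Misses i v} :=
      (c.measurableSet_color a).inter
        (measurableSet_forall_vertex hG (hc.measurableSet_misses hG i))
    convert! (hS.inter (MeasurableSet.const (i = l))).union
      (hS.compl.inter (c.measurableSet_color l)) using 1
    ext e
    simp only [Set.mem_ofPred_eq, Set.mem_union, Set.mem_inter_iff, Set.mem_compl_iff]
    split_ifs with h
    · rw [Option.some.injEq]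
      tauto
    · tauto

section Swap

variable {j : Fin k} {f : V → Bool}

lemma swap_dom (hG : IsBorel G) (hf : Measurable f) : (c.swap hG i j hf).dom = c.dom := by
  ext e
  simp only [dom, swap, Set.mem_ofPred_eq]
  split_ifs
  · cases c.color e <;> simp
  · rfl

lemma swap_colorClass (hG : IsBorel G) (hf : Measurable f) {a : Fin k} (hi : i ≠ a)
    (hj : j ≠ a) : (c.swap hG i j hf).colorClass a = c.colorClass a := by
  ext e
  simp only [colorClass, swap, Set.mem_ofPred_eq]
  split_ifs
  · simp [Equiv.swap_apply_eq_iff, Equiv.swap_apply_of_ne_of_ne hi.symm hj.symm]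
  · rfl

/-- If `f` is constant on the edges of color `i` or `j`, then swapping acts on all edges at a vertex
`v` in the same way, prescribed by `f v`. -/
lemma swap_color (hG : IsBorel G) (hf : Measurable f) (hfi : ∀ x y, c.Joined i x y → f x = f y)
    (hfj : ∀ x y, c.Joined j x y → f x = f y) {e : G.edgeSet} {v : V} (hv : v ∈ e.1) :
    (c.swap hG i j hf).color e =
      if f v = true then (c.color e).map (Equiv.swap i j) else c.color e := by
  simp only [swap]
  by_cases he : c.color e = some i ∨ c.color e = some j
  · have hiff : (∃ w ∈ e.1, f w = true) ↔ f v = true := by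
      refine ⟨?_, fun h => ⟨v, hv, h⟩⟩
      rintro ⟨w, hw, h⟩
      obtain ⟨e, hadj⟩ := e
      obtain ⟨y, rfl⟩ := hv
      have hvy : f v = f y := by
        rcases he with he | he
        exacts [hfi _ _ ⟨hadj, he⟩, hfj _ _ ⟨hadj, he⟩]
      rcases Sym2.mem_iff.1 hw with rfl | rfl
      exacts [h, hvy.trans h]
    simp only [hiff]
  · have hid : (c.color e).map (Equiv.swap i j) = c.color e := by
      cases h : c.color e with
      | none => rfl
      | some l =>
        rw [h, not_or] at he
        rw [Option.map_some,
          Equiv.swap_apply_of_ne_of_ne (by simpa using he.1) (by simpa using he.2)]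
    simp only [hid, ite_self]

lemma IsProper.swap (hG : IsBorel G) (hc : c.IsProper) (hf : Measurable f)
    (hfi : ∀ x y, c.Joined i x y → f x = f y) (hfj : ∀ x y, c.Joined j x y → f x = f y) :
    (c.swap hG i j hf).IsProper := by
  refine isProper_of_eq_of_color_eq fun e e' l he he' v hv hv' => ?_
  rw [swap_color hG hf hfi hfj hv] at he
  rw [swap_color hG hf hfi hfj hv'] at he'
  split_ifs at he he' with h
  · rw [Option.map_eq_some_iff] at he he'
    obtain ⟨m, hm, h1⟩ := he
    obtain ⟨m', hm', h2⟩ := he'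
    rw [(Equiv.swap i j).injective (h2.trans h1.symm)] at hm'
    exact hc.eq_of_color_eq hm hm' hv hv'
  · exact hc.eq_of_color_eq he he' hv hv'

/-- Swapping exchanges the colors missing at the vertices where `f` is true. -/
lemma Misses.swap (hG : IsBorel G) (hf : Measurable f)
    (hfi : ∀ x y, c.Joined i x y → f x = f y) (hfj : ∀ x y, c.Joined j x y → f x = f y) {x : V}
    (h : c.Misses (if f x = true then j else i) x) : (c.swap hG i j hf).Misses i x := by
  rintro y ⟨hadj, hy⟩
  rw [swap_color hG hf hfi hfj (v := x) (by simp)] at hy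
  split_ifs at hy h
  · rw [Option.map_eq_some_iff] at hy
    obtain ⟨m, hm, h1⟩ := hy
    rw [Equiv.swap_apply_eq_iff, Equiv.swap_apply_left] at h1
    exact h y ⟨hadj, h1 ▸ hm⟩
  · exact h y ⟨hadj, hy⟩

end Swap

section Fill

variable [StandardBorelSpace V]

lemma fill_improves (hG : IsBorel G) (hc : c.IsProper) (a i : Fin k) :
    Improves a (c.fill hG hc a i) c := by
  refine ⟨?_, ?_⟩
  · ext e
    simp only [dom, fill, Set.mem_ofPred_eq]
    split_ifs with h
    · simp [h.1]
    · rfl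
  · intro e he
    simp only [colorClass, fill, Set.mem_ofPred_eq] at he ⊢
    split_ifs at he with h
    exacts [h.1, he]

lemma IsProper.fill (hG : IsBorel G) (hc : c.IsProper) (a i : Fin k) :
    (c.fill hG hc a i).IsProper := by
  have key : ∀ (e e' : G.edgeSet) (v : V), v ∈ e'.1 → v ∈ e.1 →
      (∀ v ∈ e.1, c.Misses i v) → c.color e' ≠ some i :=
    fun e e' v hv' hv h => (h v hv).color_ne hv'
  refine isProper_of_eq_of_color_eq fun e e' l he he' v hv hv' => ?_
  simp only [PartialEdgeColoring.fill] at he he'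
  split_ifs at he he' with h h' h'
  · exact hc.eq_of_color_eq h.1 h'.1 hv hv'
  · exact absurd (he'.trans he.symm) (key e e' v hv' hv h.2)
  · exact absurd (he.trans he'.symm) (key e' e v hv hv' h'.2)
  · exact hc.eq_of_color_eq he he' hv hv'

lemma subset_diff_fill_colorClass (hG : IsBorel G) (hc : c.IsProper) {a i : Fin k} (hi : i ≠ a) :
    {e | c.color e = some a ∧ ∀ v ∈ e.1, c.Misses i v} ⊆
      c.colorClass a \ (c.fill hG hc a i).colorClass a := by
  rintro e he
  refine ⟨he.1, fun h => ?_⟩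
  simp only [colorClass, PartialEdgeColoring.fill, Set.mem_ofPred_eq] at h
  exact hi (Option.some.inj ((if_pos he).symm.trans h))

end Fill

/-! ### Reducing the measure of a color class -/

section Measure

variable [StandardBorelSpace V] (μ : Measure G.edgeSet)

/-- The edges of color `a` with one end missing the color `i` and the other end missing `j`. -/
def typeSet (c : PartialEdgeColoring G k) (a i j : Fin k) : Set G.edgeSet :=
  {e | c.color e = some a ∧ ∃ x y, e.1 = s(x, y) ∧ c.Misses i x ∧ c.Misses j y}

/-- Kempe chains starting at the two ends of an edge are different, since a common chain would close
up to an odd cycle. The coloring `d` arises by swapping the colors along a random set of chains. -/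
lemma exists_swap_of_ne [IsFiniteMeasure μ] (hG : IsBorel G) (hodd : HasNoOddCycles G)
    (hc : c.IsProper) {a j : Fin k} (hia : i ≠ a) (hja : j ≠ a) :
    ∃ d : PartialEdgeColoring G k, d.IsProper ∧ d.dom = c.dom ∧ d.colorClass a = c.colorClass a ∧
      μ (c.typeSet a i j) ≤ 8 * μ {e | d.color e = some a ∧ ∀ v ∈ e.1, d.Misses i v} := by
  classical
  obtain ⟨b, hb⟩ := hodd.exists_bool_coloring
  obtain ⟨F, hFm, hFi, hFj, hF⟩ := exists_measurable_invariant (hc.involutive_mate i)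
    (hc.involutive_mate j) (hc.measurable_mate hG i) (hc.measurable_mate hG j)
  obtain ⟨D, hDm, hDi⟩ := MeasurableSpace.measurable_injection_nat_bool_of_countablySeparated EReal
  -- the first `N` binary digits of the invariant; `A N` is the set of edges whose chains they
  -- separate
  let Q : (N : ℕ) → V → Fin N → Bool := fun N x n => D (F x) n
  have hQm : ∀ N, Measurable (Q N) := fun N =>
    measurable_pi_iff.2 fun n => (measurable_pi_iff.1 (hDm.comp hFm)) n
  let A : ℕ → Set G.edgeSet := fun N => {e | c.color e = some a ∧
    ∃ x y, e.1 = s(x, y) ∧ c.Misses i x ∧ c.Misses j y ∧ Q N x ≠ Q N y}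
  have hmi := hc.measurableSet_misses hG i
  have hmj := hc.measurableSet_misses hG j
  have hA : ∀ N, MeasurableSet (A N) := by
    intro N
    refine (c.measurableSet_color a).inter (measurableSet_exists_mem hG (P := fun x y =>
      c.Misses i x ∧ c.Misses j y ∧ Q N x ≠ Q N y) ?_)
    exact (measurable_fst hmi).inter ((measurable_snd hmj).inter
      (measurableSet_eq_fun ((hQm N).comp measurable_fst) ((hQm N).comp measurable_snd)).compl)
  have hmono : Monotone A := by
    rintro N N' hN e ⟨he, x, y, hxy, hx, hy, hne⟩
    refine ⟨he, x, y, hxy, hx, hy, fun h => hne ?_⟩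
    funext n
    exact congrFun h (Fin.castLE hN n)
  have hUnion : c.typeSet a i j = ⋃ N, A N := by
    ext e
    rw [Set.mem_iUnion]
    constructor
    · rintro ⟨he, x, y, hxy, hx, hy⟩
      have hadj : G.Adj x y := by
        have := e.2
        rwa [hxy] at this
      have hne : F x ≠ F y := by
        intro h
        obtain ⟨w, hw⟩ := hF x y hx.mate_eq hy.mate_eq h
        exact word_ne_of_bipartition (hc.involutive_mate i) (hc.involutive_mate j)
          (fun z hz => (hb _ _ (adj_mate hz)).symm) (fun z hz => (hb _ _ (adj_mate hz)).symm)
          hx.mate_eq hy.mate_eq (hb _ _ hadj) w hw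
      obtain ⟨n, hn⟩ := Function.ne_iff.1 (hDi.ne hne)
      exact ⟨n + 1, he, x, y, hxy, hx, hy, fun h => hn (congrFun h (Fin.last n))⟩
    · rintro ⟨N, he, x, y, hxy, hx, hy, -⟩
      exact ⟨he, x, y, hxy, hx, hy⟩
  -- finitely many digits suffice for half of the edges
  obtain ⟨N, hN⟩ : ∃ N, μ (c.typeSet a i j) ≤ 2 * μ (A N) := by
    rw [hUnion, hmono.measure_iUnion]
    by_contra! h
    have h2 : 2 * ⨆ N, μ (A N) ≤ ⨆ N, μ (A N) := by
      rw [ENNReal.mul_iSup]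
      exact iSup_le fun N => (h N).le
    have hfin : ⨆ N, μ (A N) ≠ ⊤ := by
      rw [← hmono.measure_iUnion]
      exact measure_ne_top _ _
    have h0 : ⨆ N, μ (A N) = 0 := by
      by_contra h0
      refine absurd h2 (not_le.2 ?_)
      rw [two_mul]
      exact ENNReal.lt_add_right hfin h0
    exact absurd (h 0) (by simp [h0])
  have hfm : ∀ g : (Fin N → Bool) → Bool, Measurable fun x => g (Q N x) :=
    fun g => (measurable_of_countable g).comp (hQm N)
  have hinv : ∀ (g : (Fin N → Bool) → Bool) (l : Fin k), (∀ x, F (c.mate l x) = F x) →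
      ∀ x y, c.Joined l x y → g (Q N x) = g (Q N y) := by
    intro g l hl x y h
    have : F x = F y := by rw [← hc.mate_eq h, hl]
    simp only [Q, this]
  have hcut : ∀ g : (Fin N → Bool) → Bool, ∃ d : PartialEdgeColoring G k, d.IsProper ∧
      d.dom = c.dom ∧ d.colorClass a = c.colorClass a ∧
      ∀ x, c.Misses (if g (Q N x) = true then j else i) x → d.Misses i x := fun g =>
    ⟨c.swap hG i j (hfm g), hc.swap hG (hfm g) (hinv g i hFi) (hinv g j hFj), swap_dom hG _,
      swap_colorClass hG _ hia hja, fun x hx => hx.swap hG (hfm g) (hinv g i hFi) (hinv g j hFj)⟩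
  choose d hd hdom hcl hmiss using hcut
  obtain ⟨g, hg⟩ := exists_cut μ (hA N)
    (fun g => {e | (d g).color e = some a ∧ ∀ v ∈ e.1, (d g).Misses i v})
    (fun g => ((d g).measurableSet_color a).inter
      (measurableSet_forall_vertex hG ((hd g).measurableSet_misses hG i))) (by
      rintro e ⟨he, x, y, hxy, hx, hy, hne⟩
      refine ⟨Q N x, Q N y, hne, fun g hgx hgy => ⟨?_, ?_⟩⟩
      · have : e ∈ (d g).colorClass a := by
          rw [hcl]
          exact he
        exact this
      · intro v hv
        rw [hxy] at hv
        rcases Sym2.mem_iff.1 hv with rfl | rfl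
        · exact hmiss g _ (by simpa [hgx] using hx)
        · exact hmiss g _ (by simpa [hgy] using hy))
  refine ⟨d g, hd g, hdom g, hcl g, hN.trans ?_⟩
  calc 2 * μ (A N) ≤ 2 * (4 * μ _) := by gcongr
    _ = 8 * μ _ := by rw [← mul_assoc]; norm_num

lemma exists_improves_of_typeSet [IsFiniteMeasure μ] (hG : IsBorel G) (hodd : HasNoOddCycles G)
    (hc : c.IsProper) {a j : Fin k} (hia : i ≠ a) (hja : j ≠ a) :
    ∃ d : PartialEdgeColoring G k, d.IsProper ∧ Improves a d c ∧
      μ (c.typeSet a i j) ≤ 8 * μ (c.colorClass a \ d.colorClass a) := by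
  rcases eq_or_ne i j with rfl | hij
  · refine ⟨c.fill hG hc a i, hc.fill hG a i, fill_improves hG hc a i, ?_⟩
    refine le_trans (measure_mono ?_) (le_mul_of_one_le_left zero_le (by norm_num))
    refine Set.Subset.trans ?_ (subset_diff_fill_colorClass hG hc hia)
    rintro e ⟨he, x, y, hxy, hx, hy⟩
    refine ⟨he, fun v hv => ?_⟩
    rw [hxy] at hv
    rcases Sym2.mem_iff.1 hv with rfl | rfl
    exacts [hx, hy]
  · obtain ⟨d, hd, hdom, hcl, hμ⟩ := exists_swap_of_ne μ hG hodd hc hia hja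
    have hfill := fill_improves hG hd a i
    refine ⟨d.fill hG hd a i, hd.fill hG a i, hfill.trans ⟨hdom, hcl.subset⟩, hμ.trans ?_⟩
    rw [← hcl]
    gcongr
    exact subset_diff_fill_colorClass hG hd hia

/-- A fixed proportion of the edges of color `a` can be recolored at once, namely those whose ends
miss a most frequent pair of colors. -/
lemma exists_improves [IsFiniteMeasure μ] (hG : IsBorel G) (hodd : HasNoOddCycles G)
    (hk : maxDegree G < k) (hc : c.IsProper) (a : Fin k) :
    ∃ d : PartialEdgeColoring G k, d.IsProper ∧ Improves a d c ∧
      μ (c.colorClass a) ≤ (k * k * 8 : ℕ) * μ (c.colorClass a \ d.colorClass a) := by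
  classical
  by_contra! h
  have hpair : ∀ i j : Fin k, i ≠ a → j ≠ a →
      (k * k : ℕ) * μ (c.typeSet a i j) < μ (c.colorClass a) := by
    intro i j hi hj
    obtain ⟨d, hd, hdc, hμ⟩ := exists_improves_of_typeSet μ hG hodd hc hi hj
    refine lt_of_le_of_lt ?_ (h d hd hdc)
    calc (k * k : ℕ) * μ (c.typeSet a i j)
        ≤ (k * k : ℕ) * (8 * μ (c.colorClass a \ d.colorClass a)) := by gcongr
      _ = _ := by push_cast; ring
  set I : Finset (Fin k × Fin k) := {p | p.1 ≠ a ∧ p.2 ≠ a}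
  have hcover : c.colorClass a ⊆ ⋃ p ∈ I, c.typeSet a p.1 p.2 := by
    rintro ⟨e, hadj⟩ he
    induction e with
    | _ x y =>
      obtain ⟨i, hi, hxi⟩ := exists_misses hk he (x := x) (by simp)
      obtain ⟨j, hj, hyj⟩ := exists_misses hk he (x := y) (by simp)
      simp only [Set.mem_iUnion]
      exact ⟨(i, j), by simp [I, hi, hj], he, x, y, rfl, hxi, hyj⟩
  have hsum : μ (c.colorClass a) ≤ ∑ p ∈ I, μ (c.typeSet a p.1 p.2) :=
    (measure_mono hcover).trans (measure_biUnion_finset_le _ _)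
  rcases I.eq_empty_or_nonempty with hI | hI
  · have h0 : μ (c.colorClass a) = 0 := by simpa [hI] using hsum
    have := h c hc ⟨rfl, subset_rfl⟩
    simp [h0] at this
  · have hlt : ∑ p ∈ I, (k * k : ℕ) * μ (c.typeSet a p.1 p.2) <
        ∑ p ∈ I, μ (c.colorClass a) := by
      refine ENNReal.sum_lt_sum_of_nonempty hI fun p hp => ?_
      simp only [I, Finset.mem_filter] at hp
      exact hpair _ _ hp.2.1 hp.2.2
    have hcard : I.card ≤ k * k := by
      simpa using Finset.card_le_univ I
    refine absurd hlt (not_lt.2 ?_)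
    rw [← Finset.mul_sum, Finset.sum_const, nsmul_eq_mul]
    gcongr

/-- The infimum of the measures of the color class over all improvements is zero, because an
improvement nearly attaining a positive infimum could be improved beyond it. -/
lemma exists_improves_lt [IsFiniteMeasure μ] (hG : IsBorel G) (hodd : HasNoOddCycles G)
    (hk : maxDegree G < k) (hc : c.IsProper) (a : Fin k) {ε : ENNReal} (hε : ε ≠ 0) :
    ∃ d : PartialEdgeColoring G k, d.IsProper ∧ Improves a d c ∧ μ (d.colorClass a) < ε := by
  set m : ENNReal := ⨅ d : {d : PartialEdgeColoring G k // d.IsProper ∧ Improves a d c},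
    μ (d.1.colorClass a)
  have hle : ∀ d : PartialEdgeColoring G k, d.IsProper → Improves a d c →
      m ≤ μ (d.colorClass a) := fun d h h' =>
    iInf_le (fun d : {d : PartialEdgeColoring G k // d.IsProper ∧ Improves a d c} =>
      μ (d.1.colorClass a)) ⟨d, h, h'⟩
  have hmtop : m ≠ ⊤ :=
    ne_top_of_le_ne_top (measure_ne_top μ (c.colorClass a)) (hle c hc ⟨rfl, subset_rfl⟩)
  set K : ENNReal := ((k * k * 8 : ℕ) : ENNReal)
  have hKtop : K ≠ ⊤ := ENNReal.natCast_ne_top _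
  have hm : m = 0 := by
    by_contra hm
    obtain ⟨⟨d, hd, hdc⟩, hlt⟩ := iInf_lt_iff.1
      (ENNReal.lt_add_right hmtop (ENNReal.div_ne_zero.2 ⟨hm, hKtop⟩) : m < m + m / K)
    obtain ⟨d', hd', hdd', hμ⟩ := exists_improves μ hG hodd hk hd a
    have h1 : m / K ≤ μ (d.colorClass a \ d'.colorClass a) :=
      ENNReal.div_le_of_le_mul' ((hle d hd hdc).trans hμ)
    have h2 : μ (d.colorClass a ∩ d'.colorClass a) + μ (d.colorClass a \ d'.colorClass a) =
        μ (d.colorClass a) := measure_inter_add_sdiff _ (d'.measurableSet_color a)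
    have h3 : d.colorClass a ∩ d'.colorClass a = d'.colorClass a :=
      Set.inter_eq_right.2 hdd'.2
    refine absurd hlt (not_lt.2 ?_)
    calc m + m / K
        ≤ μ (d'.colorClass a) + μ (d.colorClass a \ d'.colorClass a) :=
          add_le_add (hle d' hd' (hdd'.trans hdc)) h1
      _ = μ (d.colorClass a) := by rw [← h2, h3]
  obtain ⟨⟨d, hd, hdc⟩, hlt⟩ := iInf_lt_iff.1 (hm ▸ pos_iff_ne_zero.2 hε : m < ε)
  exact ⟨d, hd, hdc, hlt⟩

end Measure

end PartialEdgeColoring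

end BorelGraph

theorem proposition3p2 {V : Type*} [MeasurableSpace V] [StandardBorelSpace V]
    (G : SimpleGraph V) (hG : BorelGraph.IsBorel G) (hΔ : BorelGraph.HasBoundedDegree G)
    (hodd : BorelGraph.HasNoOddCycles G)
    (a : Fin ((BorelGraph.maxDegree G).toNat + 1))
    (c : BorelGraph.PartialEdgeColoring G ((BorelGraph.maxDegree G).toNat + 1))
    (hc : c.IsProper)
    (η : Measure G.edgeSet) [IsProbabilityMeasure η]
    (hη : BorelGraph.QuasiInvariant G.lineGraph η)
    (ε : ℝ) (hε : 0 < ε) :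
    ∃ d : BorelGraph.PartialEdgeColoring G ((BorelGraph.maxDegree G).toNat + 1),
      d.IsProper ∧ BorelGraph.PartialEdgeColoring.Improves a d c ∧
        η (d.colorClass a) < ENNReal.ofReal ε := by
  refine BorelGraph.PartialEdgeColoring.exists_improves_lt η hG hodd ?_ hc a
    (ENNReal.ofReal_pos.2 hε).ne'
  conv_lhs => rw [← ENat.natCast_toNat hΔ]
  exact_mod_cast Nat.lt_succ_self _
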